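/- Let $M\ge 1$ and let $g=(g[0],\dots,g[2M-2])$ be a real linear phase filter, i.e. $g[n]=g[2M-2-n]$ for all $n$; put $g[n]=0$ for other integers $n$. For $Q\ge 0$ let $\mathbf G_Q$ be the banded symmetric Toeplitz matrix of size $2Q+M$ with entries $(\mathbf G_Q)_{i,j}=g[M-1+j-i]$, $0\le i,j<2Q+M$. Let $\gamma\in\mathbb R$, $\mathbf G_{\mathrm{adj},Q}=\mathbf G_Q+\gamma\mathbf I$, and let $g_{\mathrm{adj}}$ be $g$ with $\gamma$ added to the centre tap $g[M-1]$. Assume that $\mathbf G_{\mathrm{adj},Q}$ is positive definite for every $Q$. For a real filter $h=(h_0,\dots,h_{N-1})$ write $H(z)=\sum_n h_n z^{-n}$ and $H(\Omega)=H(e^{i\Omega})$. A real filter $c=(c_0,\dots,c_{M-1})$ is called minimum phase if $c_0\neq 0$ and $C(z)\ne 0$ for all complex $|z|>1$ (no zeros outside the unit circle, the point at infinity included). It solves the Orchard–Wilson equations for $g_{\mathrm{adj}}$ if $$\sum_{i=0}^{M-1-k} c_i c_{i+k}=g_{\mathrm{adj}}[M-1-k],\qquad k=0,\dots,M-1 .$$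 Then: 1. For every $Q$ there is exactly one Cholesky factor $\mathbf C_Q$ of $\mathbf G_{\mathrm{adj},Q}$, i.e. one upper triangular matrix with positive diagonal such that $\mathbf G_{\mathrm{adj},Q}=\mathbf C_Q^{\mathrm T}\mathbf C_Q$. 2. A real filter $c$ with $M$ taps solves the Orchard–Wilson equations for $g_{\mathrm{adj}}$ if and only if $G_{\mathrm{adj}}(z)=C(z)\hat C(z)$ for all complex $z\ne0$, where $\hat C(z)=\sum_{n=0}^{M-1} c_{M-1-n}z^{-n}$. 3. There is a real filter $c=(c_0,\dots,c_{M-1})$, put $c_n=0$ for other integers $n$, such that: (a) the rows of $\mathbf C_Q$ near the symmetry point converge to the taps of $c$: for every $R\in\mathbb N$ and $\varepsilon>0$, for all sufficiently large $Q$, $|(\mathbf C_Q)_{i,j}-c_{j-i}|<\varepsilon$ for all rows $i$ with $|i-(Q+M-1)|\le R$ and all columns $j$; (b) $c_{\mathrm{approx}}\to c$ as $Q\to\infty$, where $c_{\mathrm{approx}}=\big((\mathbf C_Q)_{Q+M-1-k,\;Q+M-1}\big)_{k=0}^{M-1}$ consists of the entries $Q+M-1,Q+M-2,\dots,Q$ (in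 this order) of $\mathbf C_Q\delta_{\mathrm{aug}}$, with $\delta_{\mathrm{aug}}$ the unit vector with its one at position $Q+M-1$ (positions counted from $0$); (c) $c$ solves the Orchard–Wilson equations for $g_{\mathrm{adj}}$, is minimum phase, and has $c_0>0$; if moreover the eigenvalues of all $\mathbf G_{\mathrm{adj},Q}$ are bounded below by one positive constant that does not depend on $Q$, then all zeros of $C(z)$ lie strictly inside the unit circle, i.e. $C(z)\ne0$ for all $|z|\ge1$; (d) $|C(\Omega)|=|H(\Omega)|$ for all real $\Omega$, for every real filter $h$ with $M$ taps that solves the Orchard–Wilson equations for $g_{\mathrm{adj}}$; (e) $c$ is unique: every real minimum phase filter with $M$ taps that solves the Orchard–Wilson equations for $g_{\mathrm{adj}}$ is equal to $c$ or to $-c$. -/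

import Mathlib

open Filter Topology

namespace FIR

/-- The `n`-th tap `h[n]` of a finite impulse response with `N` taps, for every integer time `n`;
it is zero outside `0 ≤ n < N`. -/
def tap {N : ℕ} (h : Fin N → ℝ) (n : ℤ) : ℝ :=
  if hn : 0 ≤ n ∧ n < N then h ⟨n.toNat, by omega⟩ else 0

/-- The `Z` transform `H(z) = ∑ h[n] z⁻ⁿ` (meaningful for `z ≠ 0`). -/
noncomputable def zTransform {N : ℕ} (h : Fin N → ℝ) (z : ℂ) : ℂ :=
  ∑ n : Fin N, (h n : ℂ) * (z⁻¹) ^ (n : ℕ)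

/-- The frequency response `H(Ω) = H(z = e^{iΩ})`. -/
noncomputable def freqResponse {N : ℕ} (h : Fin N → ℝ) (Ω : ℝ) : ℂ :=
  zTransform h (Complex.exp (Complex.I * Ω))

/-- The time-reflected filter. -/
def reflect {N : ℕ} (h : Fin N → ℝ) : Fin N → ℝ := fun n => h n.rev

/-- A (symmetric) linear phase filter: the taps are symmetric about the centre tap. -/
def IsLinearPhase {N : ℕ} (g : Fin N → ℝ) : Prop := reflect g = g

/-- The lifted filter: `γ` is added to the centre tap (number `M - 1`) of a filter with
`2M - 1` taps. -/
def lift {M : ℕ} (g : Fin (2 * M - 1) → ℝ) (γ : ℝ) : Fin (2 * M - 1) → ℝ :=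
  fun n => g n + if (n : ℕ) = M - 1 then γ else 0

/-- The banded Toeplitz matrix of size `2Q + M` that represents the filter `g` with `2M - 1` taps:
the centre tap is on the main diagonal. -/
def gramian {M : ℕ} (g : Fin (2 * M - 1) → ℝ) (Q : ℕ) :
    Matrix (Fin (2 * Q + M)) (Fin (2 * Q + M)) ℝ :=
  Matrix.of fun i j => tap g ((M : ℤ) - 1 + ((j : ℤ) - (i : ℤ)))

/-- The regularized matrix `G + γ I`. -/
def gramianAdj {M : ℕ} (g : Fin (2 * M - 1) → ℝ) (γ : ℝ) (Q : ℕ) :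
    Matrix (Fin (2 * Q + M)) (Fin (2 * Q + M)) ℝ :=
  gramian g Q + γ • (1 : Matrix (Fin (2 * Q + M)) (Fin (2 * Q + M)) ℝ)

/-- `C` is the Cholesky factor of `A`: upper triangular with positive diagonal, and
`A = Cᵀ C`. -/
structure IsCholeskyFactor {n : ℕ} (A C : Matrix (Fin n) (Fin n) ℝ) : Prop where
  upper : ∀ i j, j < i → C i j = 0
  diag_pos : ∀ i, 0 < C i i
  factor : A = C.transpose * C

/-- The augmented Kronecker delta: `Q` zeros, `M - 1` zeros, a one, `Q` zeros. -/
def deltaAug (M Q : ℕ) : Fin (2 * Q + M) → ℝ :=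
  fun i => if (i : ℕ) = Q + (M - 1) then 1 else 0

/-- The approximate filter `(c₀, …, c_{M-1})` read off from
`C δ_aug = (0, …, 0, c_{M-1}, …, c₁, c₀, 0, …, 0)`, with `Q` entries before and after. -/
def cApprox {M Q : ℕ} (C : Matrix (Fin (2 * Q + M)) (Fin (2 * Q + M)) ℝ) : Fin M → ℝ :=
  fun k => (C.mulVec (deltaAug M Q)) ⟨Q + (M - 1 - (k : ℕ)), by omega⟩

/-- The Orchard–Wilson equations: `∑ᵢ cᵢ cᵢ₊ₖ = g[M - 1 - k]` for `k = 0, …, M - 1`. -/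
def SolvesOrchardWilson {M : ℕ} (c : Fin M → ℝ) (g : Fin (2 * M - 1) → ℝ) : Prop :=
  ∀ k : Fin M,
    ∑ i ∈ Finset.range (M - k), tap c i * tap c (i + (k : ℕ)) = tap g ((M : ℤ) - 1 - (k : ℕ))

/-- Factorization on the `Z` domain: `G(z) = C(z) Ĉ(z)`, where `Ĉ` belongs to the time-reflected
filter. -/
def IsSpectralFactor {M : ℕ} (c : Fin M → ℝ) (g : Fin (2 * M - 1) → ℝ) : Prop :=
  ∀ z : ℂ, z ≠ 0 → zTransform g z = zTransform c z * zTransform (reflect c) z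

/-- Minimum phase: `C(z)` has no zero outside the unit circle, the point at infinity (where `C`
takes the value `c[0]`) included. All poles of `C(z)` are at `z = 0`. -/
def IsMinimumPhase {M : ℕ} (c : Fin M → ℝ) : Prop :=
  tap c 0 ≠ 0 ∧ ∀ z : ℂ, 1 < ‖z‖ → zTransform c z ≠ 0

end FIR

/-!
Read as a kernel on `ℕ × ℕ`, the Toeplitz matrices of all sizes are the leading blocks of one
banded positive definite kernel `A`, and by uniqueness their Cholesky factors are the leading blocks
of one infinite upper triangular array `chol A` (`isCholeskyFactor_iff`).

*Convergence.* Row `i` of the factor is the pivot row of the `i`-th Schur complement, divided by the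
square root of the pivot. The form of the Schur complement is the minimum of the full form over the
first `i` coordinates (`qform_schur_le`, `exists_qform_eq_schur`). Shifting a minimizer by one place
leaves a Toeplitz form unchanged and makes room for one more coordinate, so these minima decrease in
`i` (`pivotForm_antitone`) and converge. The limit of the pivots is positive because the outermost
nonzero entry of the band is the product of a pivot and an entry of the factor, which is bounded
(`exists_le_chol_diag`). Passing to the limit in `A = Cᵀ C` gives the Orchard–Wilson equations
(`autocorrelation_of_tendsto`).

*Zeros.* By the Orchard–Wilson equations the Toeplitz form of `p` is the sum of the squared
coefficients of `c * p` (`qform_eq_energy`), with polynomials in `w = z⁻¹`. Its infimum over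
`p(0) = 1` is `c(0)²`, the limit of the pivots. If `c` had a zero `w` with `0 < |w| < 1`, reflecting
it at the circle would preserve this sum and show that the infimum is at least `c(0)² / |w|²`
(`eval_ne_zero_of_energy_lt`). If the eigenvalues are bounded below, a zero on the circle is
excluded by testing with long truncated geometric series (`eval_ne_zero_of_energy_bounded_below`).

*Uniqueness.* The product of `c` with its reciprocal polynomial determines all zeros of `c` if none
of them is in the open disc, by removing common zeros one at a time
(`eq_C_mul_of_mul_conjReflect_eq`). The remaining real factor has square one.
-/

namespace FIR

/-! ### Cholesky factorization of an infinite kernel -/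

section Cholesky

/-- The quadratic form of the leading `n × n` block of the kernel `A`. -/
def qform (A : ℕ → ℕ → ℝ) (n : ℕ) (x : ℕ → ℝ) : ℝ :=
  ∑ a ∈ Finset.range n, ∑ b ∈ Finset.range n, x a * x b * A a b

/-- A symmetric kernel on `ℕ` all of whose leading blocks are positive definite. -/
structure IsPosDefKernel (A : ℕ → ℕ → ℝ) : Prop where
  symm : ∀ a b, A a b = A b a
  pos : ∀ n x, (∃ a < n, x a ≠ 0) → 0 < qform A n x

/-- The upper triangular Cholesky factor of the infinite kernel `A`, computed row by row. It is
the factor only if all the pivots under the square root are positive. -/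
noncomputable def chol (A : ℕ → ℕ → ℝ) : ℕ → ℕ → ℝ
  | i => fun j => if j < i then 0 else
      (A i j - ∑ k : Fin i, chol A k i * chol A k j) /
        √(A i i - ∑ k : Fin i, chol A k i * chol A k i)
  termination_by i => i
  decreasing_by all_goals exact k.2

/-- The Schur complement of the leading `i × i` block of `A`, indexed by all of `ℕ × ℕ`. -/
noncomputable def schur (A : ℕ → ℕ → ℝ) (i a b : ℕ) : ℝ :=
  A a b - ∑ k ∈ Finset.range i, chol A k a * chol A k b

variable {A : ℕ → ℕ → ℝ}

lemma chol_of_lt {i j : ℕ} (h : j < i) : chol A i j = 0 := by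
  rw [chol]; simp [h]

lemma chol_of_le {i j : ℕ} (h : i ≤ j) : chol A i j = schur A i i j / √(schur A i i i) := by
  rw [chol]
  simp only [not_lt.2 h, if_false, schur, Finset.sum_range]

lemma schur_zero (a b : ℕ) : schur A 0 a b = A a b := by simp [schur]

lemma schur_succ (i a b : ℕ) :
    schur A (i + 1) a b = schur A i a b - chol A i a * chol A i b := by
  simp only [schur, Finset.sum_range_succ]; ring

lemma schur_symm (hA : ∀ a b, A a b = A b a) (i a b : ℕ) : schur A i a b = schur A i b a := by
  simp only [schur, hA a b, mul_comm]

/-- Completing squares: elimination of the first `i` variables splits the form into `i` squares and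
the form of the Schur complement. -/
lemma qform_eq_add_schur (i n : ℕ) (x : ℕ → ℝ) :
    qform A n x = ∑ k ∈ Finset.range i, (∑ l ∈ Finset.range n, chol A k l * x l) ^ 2 +
      qform (schur A i) n x := by
  induction i with
  | zero => simp [qform, schur_zero]
  | succ i ih =>
    rw [ih, Finset.sum_range_succ, add_assoc]
    congr 1
    rw [sq, Finset.sum_mul_sum, qform, qform, ← Finset.sum_add_distrib]
    refine Finset.sum_congr rfl fun a _ => ?_
    rw [← Finset.sum_add_distrib]
    refine Finset.sum_congr rfl fun b _ => ?_
    rw [schur_succ]; ring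

lemma chol_mul_diag {i j : ℕ} (hp : 0 < schur A i i i) (hij : i ≤ j) :
    chol A i i * chol A i j = schur A i i j := by
  rw [chol_of_le le_rfl, chol_of_le hij, div_mul_div_comm, Real.mul_self_sqrt hp.le]
  field_simp

/-- As long as the pivots are positive, elimination clears the eliminated rows. -/
lemma schur_eq_zero (hA : ∀ a b, A a b = A b a) {i : ℕ} (hp : ∀ k < i, 0 < schur A k k k)
    {a : ℕ} (ha : a < i) (b : ℕ) : schur A i a b = 0 := by
  induction i generalizing a b with
  | zero => omega
  | succ i ih =>
    have ih' := fun {a : ℕ} => @ih (fun k hk => hp k (by omega)) a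
    rw [schur_succ]
    rcases Nat.lt_succ_iff_lt_or_eq.1 ha with h | rfl
    · rw [ih' h, chol_of_lt h]; simp
    · rcases lt_or_ge b a with hb | hb
      · rw [schur_symm hA, ih' hb, chol_of_lt hb]; simp
      · rw [chol_mul_diag (hp a (by omega)) hb, sub_self]

lemma chol_diag_pos {i : ℕ} (hp : 0 < schur A i i i) : 0 < chol A i i := by
  rw [chol_of_le le_rfl]; positivity

/-- Back substitution in a triangular system. -/
lemma exists_chol_solve {i : ℕ} (hp : ∀ k < i, 0 < schur A k k k) (r : ℕ → ℝ) :
    ∃ y : ℕ → ℝ, ∀ k < i, ∑ l ∈ Finset.range i, chol A k l * y l = r k := by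
  let U : Matrix (Fin i) (Fin i) ℝ := Matrix.of fun a b => chol A a b
  have hU : U.det ≠ 0 := by
    rw [Matrix.det_of_isUpperTriangular (M := U) (fun a b h => chol_of_lt h)]
    exact Finset.prod_ne_zero_iff.2 fun a _ => (chol_diag_pos (hp a a.2)).ne'
  have hs : Function.Surjective U.mulVec :=
    Matrix.mulVec_surjective_iff_isUnit.2 ((Matrix.isUnit_iff_isUnit_det _).2 hU.isUnit)
  obtain ⟨y, hy⟩ := hs fun k => r k
  refine ⟨fun l => if h : l < i then y ⟨l, h⟩ else 0, fun k hk => ?_⟩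
  have := congrFun hy ⟨k, hk⟩
  rw [← this, Finset.sum_range]
  simp [Matrix.mulVec, dotProduct, U]

lemma qform_congr {B : ℕ → ℕ → ℝ} {i n : ℕ} {x w : ℕ → ℝ} (hB : ∀ a b, B a b = B b a)
    (h0 : ∀ a < i, ∀ b, B a b = 0) (h : ∀ a, i ≤ a → x a = w a) :
    qform B n x = qform B n w := by
  refine Finset.sum_congr rfl fun a _ => Finset.sum_congr rfl fun b _ => ?_
  rcases lt_or_ge a i with ha | ha
  · simp [h0 a ha]
  rcases lt_or_ge b i with hb | hb
  · simp [hB a b, h0 b hb]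
  rw [h a ha, h b hb]

/-- The form of a Schur complement is attained as a value of the full form, after a suitable
choice of the first `i` coordinates. -/
lemma exists_qform_eq_schur (hA : ∀ a b, A a b = A b a) {i n : ℕ} (hin : i ≤ n)
    (hp : ∀ k < i, 0 < schur A k k k) (w : ℕ → ℝ) :
    ∃ x : ℕ → ℝ, (∀ a, i ≤ a → x a = w a) ∧ qform A n x = qform (schur A i) n w := by
  obtain ⟨y, hy⟩ := exists_chol_solve hp fun k => -∑ l ∈ Finset.Ico i n, chol A k l * w l
  refine ⟨fun a => if a < i then y a else w a, fun a ha => by simp [not_lt.2 ha], ?_⟩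
  have hw : ∀ a, i ≤ a → (fun a => if a < i then y a else w a) a = w a :=
    fun a ha => by simp [not_lt.2 ha]
  rw [qform_eq_add_schur i,
    qform_congr (schur_symm hA i) (fun a ha b => schur_eq_zero hA hp ha b) hw,
    Finset.sum_eq_zero, zero_add]
  intro k hk
  have h1 : ∀ l ∈ Finset.range i, chol A k l * (if l < i then y l else w l) = chol A k l * y l :=
    fun l hl => by rw [if_pos (Finset.mem_range.1 hl)]
  have h2 : ∀ l ∈ Finset.Ico i n, chol A k l * (if l < i then y l else w l) = chol A k l * w l :=
    fun l hl => by rw [if_neg (not_lt.2 (Finset.mem_Ico.1 hl).1)]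
  rw [← Finset.sum_range_add_sum_Ico _ hin, Finset.sum_congr rfl h1, Finset.sum_congr rfl h2,
    hy k (Finset.mem_range.1 hk)]
  simp

lemma qform_schur_le (i n : ℕ) (x : ℕ → ℝ) : qform (schur A i) n x ≤ qform A n x := by
  rw [qform_eq_add_schur (A := A) i]
  exact le_add_of_nonneg_left (Finset.sum_nonneg fun _ _ => sq_nonneg _)

lemma qform_single (B : ℕ → ℕ → ℝ) (i : ℕ) : qform B (i + 1) (Pi.single i 1) = B i i := by
  rw [qform, Finset.sum_eq_single i, Finset.sum_eq_single i]
  · simp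
  · intro b _ hb; simp [Pi.single_eq_of_ne hb]
  · simp
  · intro a _ ha; simp [Pi.single_eq_of_ne ha]
  · simp

lemma IsPosDefKernel.qform_nonneg (hA : IsPosDefKernel A) (n : ℕ) (x : ℕ → ℝ) :
    0 ≤ qform A n x := by
  by_cases h : ∃ a < n, x a ≠ 0
  · exact (hA.pos n x h).le
  · push Not at h
    refine (Finset.sum_eq_zero fun a ha => Finset.sum_eq_zero fun b _ => ?_).ge
    simp [h a (Finset.mem_range.1 ha)]

/-- All pivots of a positive definite kernel are positive. -/
lemma IsPosDefKernel.schur_pos (hA : IsPosDefKernel A) (i : ℕ) : 0 < schur A i i i := by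
  induction i using Nat.strong_induction_on with
  | _ i ih =>
    obtain ⟨x, hx, hq⟩ := exists_qform_eq_schur hA.symm (Nat.le_succ i) ih (Pi.single i 1)
    rw [Nat.succ_eq_add_one, qform_single] at hq
    rw [← hq]
    exact hA.pos _ _ ⟨i, by omega, by simp [hx i le_rfl]⟩

lemma IsPosDefKernel.chol_diag_pos (hA : IsPosDefKernel A) (i : ℕ) : 0 < chol A i i :=
  FIR.chol_diag_pos (hA.schur_pos i)

lemma IsPosDefKernel.eq_sum_chol (hA : IsPosDefKernel A) {n a : ℕ} (ha : a < n) (b : ℕ) :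
    A a b = ∑ k ∈ Finset.range n, chol A k a * chol A k b :=
  sub_eq_zero.1 (schur_eq_zero hA.symm (fun k _ => hA.schur_pos k) ha b)

lemma IsPosDefKernel.chol_sq_le (hA : IsPosDefKernel A) (i j : ℕ) : chol A i j ^ 2 ≤ A j j := by
  rcases lt_or_ge j i with h | h
  · have := hA.eq_sum_chol (Nat.lt_succ_self j) j
    rw [chol_of_lt h, this]
    simpa using Finset.sum_nonneg fun k _ => mul_self_nonneg (chol A k j)
  · rw [hA.eq_sum_chol (Nat.lt_succ_self j) j, sq]
    exact Finset.single_le_sum (f := fun k => chol A k j * chol A k j)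
      (fun k _ => mul_self_nonneg _) (Finset.mem_range.2 (by omega))

/-- The Cholesky factor of a banded kernel is banded. -/
lemma chol_eq_zero_of_band {m : ℕ} (hm : ∀ a b, a + m ≤ b → A a b = 0) {i j : ℕ}
    (h : i + m ≤ j) : chol A i j = 0 := by
  induction i using Nat.strong_induction_on generalizing j with
  | _ i ih =>
    rw [chol_of_le (by omega), schur, hm i j h, Finset.sum_eq_zero]
    · simp
    · intro k hk
      have := Finset.mem_range.1 hk
      rw [ih k this (by omega : k + m ≤ j), mul_zero]

/-! ### Convergence of the rows for a Toeplitz kernel -/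

section Toeplitz

lemma toeplitz_add (hT : ∀ a b, A (a + 1) (b + 1) = A a b) (s a b : ℕ) :
    A (s + a) (s + b) = A a b := by
  induction s with
  | zero => simp
  | succ s ih => rw [← ih, ← hT (s + a), add_right_comm s 1 a, add_right_comm s 1 b]

/-- The form of the `i`-th Schur complement, in coordinates that start at the pivot. -/
noncomputable def pivotForm (A : ℕ → ℕ → ℝ) (n : ℕ) (w : ℕ → ℝ) (i : ℕ) : ℝ :=
  qform (fun a b => schur A i (i + a) (i + b)) n w

lemma pivotForm_eq (hA : IsPosDefKernel A) (n i : ℕ) (w : ℕ → ℝ) :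
    pivotForm A n w i = qform (schur A i) (i + n) fun a => w (a - i) := by
  have hs : ∀ f : ℕ → ℝ, (∀ a < i, f a = 0) →
      ∑ a ∈ Finset.range (i + n), f a = ∑ a ∈ Finset.range n, f (i + a) := fun f hf => by
    rw [Finset.sum_range_add, add_eq_right]
    exact Finset.sum_eq_zero fun a ha => hf a (Finset.mem_range.1 ha)
  have h0 : ∀ a < i, ∀ b, schur A i a b = 0 := fun a ha b =>
    schur_eq_zero hA.symm (fun k _ => hA.schur_pos k) ha b
  unfold pivotForm qform
  rw [hs]
  · refine Finset.sum_congr rfl fun a _ => ?_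
    rw [hs]
    · simp
    · intro b hb
      rw [schur_symm hA.symm, h0 b hb, mul_zero]
  · intro a ha
    exact Finset.sum_eq_zero fun b _ => by rw [h0 a ha, mul_zero]

lemma pivotForm_nonneg (hA : IsPosDefKernel A) (n i : ℕ) (w : ℕ → ℝ) :
    0 ≤ pivotForm A n w i := by
  obtain ⟨x, -, hx⟩ := exists_qform_eq_schur hA.symm (Nat.le_add_right i n)
    (fun k _ => hA.schur_pos k) fun a => w (a - i)
  rw [pivotForm_eq hA, ← hx]
  exact hA.qform_nonneg _ _

/-- A longer past gives a smaller prediction error: by the Toeplitz property a minimizer over `i`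
past coordinates is, after a shift, a candidate for `i + 1` of them. -/
lemma pivotForm_antitone (hA : IsPosDefKernel A) (hT : ∀ a b, A (a + 1) (b + 1) = A a b)
    (n : ℕ) (w : ℕ → ℝ) : Antitone (pivotForm A n w) := by
  refine antitone_nat_of_succ_le fun i => ?_
  obtain ⟨x, hxw, hx⟩ := exists_qform_eq_schur hA.symm (Nat.le_add_right i n)
    (fun k _ => hA.schur_pos k) fun a => w (a - i)
  rw [pivotForm_eq hA n i, ← hx, pivotForm_eq hA]
  let x' : ℕ → ℝ := fun a => if a = 0 then 0 else x (a - 1)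
  have h1 : qform A (i + 1 + n) x' = qform A (i + n) x := by
    rw [show i + 1 + n = i + n + 1 by omega]
    simp [qform, Finset.sum_range_succ', x', hT]
  rw [← h1, ← qform_congr (schur_symm hA.symm (i + 1))
    (fun a ha b => schur_eq_zero hA.symm (fun k _ => hA.schur_pos k) ha b) (x := x')]
  · exact qform_schur_le _ _ _
  · intro a ha
    simp only [x', if_neg (show a ≠ 0 by omega), hxw (a - 1) (by omega)]
    congr 1; omega

lemma qform_polarization (B : ℕ → ℕ → ℝ) (hB : ∀ a b, B a b = B b a) (k : ℕ) :
    B 0 k = (qform B (k + 1) (Pi.single 0 1 + Pi.single k 1) -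
      qform B (k + 1) (Pi.single 0 1 - Pi.single k 1)) / 4 := by
  have h : ∀ e : ℝ, qform B (k + 1) (fun a => (if a = 0 then 1 else 0) + e * if a = k then 1 else 0)
      = B 0 0 + 2 * e * B 0 k + e ^ 2 * B k k := by
    intro e
    have h0 : 0 ∈ Finset.range (k + 1) := by simp
    have hk : k ∈ Finset.range (k + 1) := by simp
    simp only [qform, add_mul, mul_add, Finset.sum_add_distrib, ite_mul, mul_ite, mul_one, one_mul,
      mul_zero, zero_mul, Finset.sum_ite_eq', if_pos h0, if_pos hk]
    rw [hB k 0]; ring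
  have h1 := h 1
  have h2 := h (-1)
  have e1 : (Pi.single 0 1 + Pi.single k 1 : ℕ → ℝ) =
      fun a => (if a = 0 then 1 else 0) + 1 * if a = k then 1 else 0 := by
    ext a; simp [Pi.single_apply]
  have e2 : (Pi.single 0 1 - Pi.single k 1 : ℕ → ℝ) =
      fun a => (if a = 0 then 1 else 0) + (-1) * if a = k then 1 else 0 := by
    ext a; simp only [Pi.sub_apply, Pi.single_apply]; ring
  rw [e1, e2, h1, h2]; ring

/-- The pivot rows of the Schur complements converge: the values of the forms decrease, and the
entries are recovered from them by polarization. -/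
lemma exists_tendsto_schur (hA : IsPosDefKernel A) (hT : ∀ a b, A (a + 1) (b + 1) = A a b)
    (k : ℕ) : ∃ s, Tendsto (fun i => schur A i i (i + k)) atTop (𝓝 s) := by
  have h : ∀ w, ∃ s, Tendsto (pivotForm A (k + 1) w) atTop (𝓝 s) := fun w =>
    ⟨_, tendsto_atTop_ciInf (pivotForm_antitone hA hT _ w)
      ⟨0, Set.forall_mem_range.2 fun i => pivotForm_nonneg hA _ i w⟩⟩
  obtain ⟨s, hs⟩ := h (Pi.single 0 1 + Pi.single k 1)
  obtain ⟨s', hs'⟩ := h (Pi.single 0 1 - Pi.single k 1)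
  refine ⟨_, ((hs.sub hs').div_const 4).congr fun i => ?_⟩
  exact (qform_polarization (fun a b => schur A i (i + a) (i + b))
    (fun a b => schur_symm hA.symm i _ _) k).symm

/-- The pivots of a banded Toeplitz kernel stay away from zero: if `m` is the exact bandwidth, the
outermost entry `A 0 m ≠ 0` is the product of a pivot and a bounded entry. -/
lemma exists_le_chol_diag (hA : IsPosDefKernel A) (hT : ∀ a b, A (a + 1) (b + 1) = A a b)
    {M : ℕ} (hM : ∀ a b, a + M ≤ b → A a b = 0) : ∃ δ > 0, ∀ i, δ ≤ chol A i i := by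
  have h00 : 0 < A 0 0 := by simpa [schur_zero] using hA.schur_pos 0
  have hsh : ∀ a d, A a (a + d) = A 0 d := fun a d => by simpa using toeplitz_add hT a 0 d
  let P : ℕ → Prop := fun m => A 0 m ≠ 0
  have hM0 : 0 < M := by
    by_contra h
    exact h00.ne' (hM 0 0 (by omega))
  classical
  let m := Nat.findGreatest P M
  have hm : A 0 m ≠ 0 := Nat.findGreatest_spec (P := P) (Nat.zero_le M) h00.ne'
  have hband : ∀ a b, a + (m + 1) ≤ b → A a b = 0 := by
    intro a b hab
    obtain ⟨d, rfl⟩ := Nat.exists_eq_add_of_le (show a ≤ b by omega)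
    rcases lt_or_ge d M with hd | hd
    · rw [hsh]
      by_contra h
      exact Nat.findGreatest_is_greatest (P := P) (show m < d by omega) hd.le h
    · exact hM _ _ (by omega)
  refine ⟨|A 0 m| / √(A 0 0), by positivity, fun i => ?_⟩
  have h1 : A 0 m = chol A i i * chol A i (i + m) := by
    rw [← hsh i m, hA.eq_sum_chol (Nat.lt_succ_self i), Finset.sum_range_succ,
      Finset.sum_eq_zero, zero_add]
    intro k hk
    have := Finset.mem_range.1 hk
    rw [chol_eq_zero_of_band hband (show k + (m + 1) ≤ i + m by omega), mul_zero]
  have h2 : |chol A i (i + m)| ≤ √(A 0 0) := by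
    rw [← Real.sqrt_sq_eq_abs]
    refine Real.sqrt_le_sqrt ((hA.chol_sq_le _ _).trans_eq ?_)
    simpa using toeplitz_add hT (i + m) 0 0
  rw [div_le_iff₀ (by positivity), h1, abs_mul, abs_of_pos (hA.chol_diag_pos i)]
  exact mul_le_mul_of_nonneg_left h2 (hA.chol_diag_pos i).le

lemma exists_tendsto_chol (hA : IsPosDefKernel A) (hT : ∀ a b, A (a + 1) (b + 1) = A a b)
    {M : ℕ} (hM : ∀ a b, a + M ≤ b → A a b = 0) :
    ∃ c : ℕ → ℝ, 0 < c 0 ∧ ∀ k, Tendsto (fun i => chol A i (i + k)) atTop (𝓝 (c k)) := by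
  choose s hs using exists_tendsto_schur hA hT
  obtain ⟨δ, hδ, hle⟩ := exists_le_chol_diag hA hT hM
  have hsq : ∀ i, √(schur A i i i) = chol A i i := fun i => by
    rw [← chol_mul_diag (hA.schur_pos i) le_rfl, Real.sqrt_mul_self (hA.chol_diag_pos i).le]
  have h0 : Tendsto (fun i => chol A i i) atTop (𝓝 √(s 0)) :=
    ((hs 0).sqrt).congr hsq
  have hpos : 0 < √(s 0) := hδ.trans_le (ge_of_tendsto' h0 hle)
  have hlim : ∀ k, Tendsto (fun i => chol A i (i + k)) atTop (𝓝 (s k / √(s 0))) := fun k =>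
    ((hs k).div h0 hpos.ne').congr fun i => by
      rw [chol_of_le (Nat.le_add_right i k), hsq]; rfl
  exact ⟨_, by rwa [tendsto_nhds_unique (hlim 0) h0], hlim⟩

/-- The limit of the rows has the kernel as its autocorrelation. -/
lemma autocorrelation_of_tendsto (hA : IsPosDefKernel A)
    (hT : ∀ a b, A (a + 1) (b + 1) = A a b) {M : ℕ} (hM : ∀ a b, a + M ≤ b → A a b = 0)
    {c : ℕ → ℝ} (hc : ∀ k, Tendsto (fun i => chol A i (i + k)) atTop (𝓝 (c k))) (d : ℕ) :
    ∑ s ∈ Finset.range M, c s * c (s + d) = A 0 d := by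
  have h : Tendsto (fun i => ∑ s ∈ Finset.range M, chol A (i - s) (i - s + s) *
      chol A (i - s) (i - s + (s + d))) atTop (𝓝 (∑ s ∈ Finset.range M, c s * c (s + d))) :=
    tendsto_finsetSum _ fun s _ =>
      ((hc s).comp (tendsto_sub_atTop_nat s)).mul ((hc (s + d)).comp (tendsto_sub_atTop_nat s))
  refine tendsto_nhds_unique h (tendsto_const_nhds.congr' ?_)
  filter_upwards [eventually_ge_atTop M] with i hi
  rw [show A 0 d = A i (i + d) by simpa using (toeplitz_add hT i 0 d).symm,
    hA.eq_sum_chol (Nat.lt_succ_self i), ← Finset.sum_range_reflect,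
    ← Finset.sum_range_add_sum_Ico _ (show M ≤ i.succ by omega),
    Finset.sum_eq_zero (s := Finset.Ico _ _), add_zero]
  · refine Finset.sum_congr rfl fun s hs => ?_
    have := Finset.mem_range.1 hs
    congr 2 <;> omega
  · intro s hs
    have := Finset.mem_Ico.1 hs
    rw [chol_eq_zero_of_band hM (by omega), zero_mul]

/-- The limiting pivot is the infimum of the form over sequences that end in a one. -/
lemma exists_qform_lt (hA : IsPosDefKernel A)
    {c : ℕ → ℝ} (hc : Tendsto (fun i => chol A i i) atTop (𝓝 (c 0))) {r : ℝ} (hr : c 0 ^ 2 < r) :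
    ∃ (n : ℕ) (x : ℕ → ℝ), x n = 1 ∧ qform A (n + 1) x < r := by
  obtain ⟨n, hn⟩ := ((hc.pow 2).eventually (gt_mem_nhds hr)).exists
  obtain ⟨x, hx, hq⟩ := exists_qform_eq_schur hA.symm (Nat.le_succ n) (fun k _ => hA.schur_pos k)
    (Pi.single n 1)
  refine ⟨n, x, by simp [hx n le_rfl], ?_⟩
  rw [Nat.succ_eq_add_one, qform_single, ← chol_mul_diag (hA.schur_pos n) le_rfl, ← sq] at hq
  rwa [hq]

end Toeplitz

end Cholesky

/-! ### Coefficient energy of polynomials -/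

section Energy

open Polynomial ComplexConjugate

/-- The energy of a polynomial: the sum of the squared moduli of its coefficients. -/
noncomputable def energy {R : Type*} [NormedRing R] (P : R[X]) : ℝ := P.sum fun _ a => ‖a‖ ^ 2

variable {R : Type*} [NormedRing R]

lemma energy_eq (P : R[X]) {N : ℕ} (h : P.natDegree < N) :
    energy P = ∑ n ∈ Finset.range N, ‖P.coeff n‖ ^ 2 :=
  P.sum_over_range' (fun _ => by simp) N h

lemma norm_coeff_zero_sq_le_energy (P : R[X]) : ‖P.coeff 0‖ ^ 2 ≤ energy P := by
  rw [energy_eq P (Nat.lt_succ_self _)]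
  exact Finset.single_le_sum (f := fun n => ‖P.coeff n‖ ^ 2) (fun _ _ => by positivity)
    (by simp)

lemma energy_sub_le (P Q : R[X]) : energy (P - Q) ≤ 2 * energy P + 2 * energy Q := by
  have hN : ∃ N, P.natDegree < N ∧ Q.natDegree < N ∧ (P - Q).natDegree < N :=
    ⟨P.natDegree + Q.natDegree + (P - Q).natDegree + 1, by omega, by omega, by omega⟩
  obtain ⟨N, h1, h2, h3⟩ := hN
  rw [energy_eq P h1, energy_eq Q h2, energy_eq _ h3, Finset.mul_sum, Finset.mul_sum,
    ← Finset.sum_add_distrib]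
  refine Finset.sum_le_sum fun n _ => ?_
  rw [coeff_sub]
  nlinarith [norm_sub_le (P.coeff n) (Q.coeff n), norm_nonneg (P.coeff n - Q.coeff n),
    sq_nonneg (‖P.coeff n‖ - ‖Q.coeff n‖), norm_nonneg (P.coeff n), norm_nonneg (Q.coeff n)]

lemma energy_X_mul (P : R[X]) : energy (X * P) = energy P := by
  rw [energy_eq (X * P) (N := P.natDegree + 1 + 1)
    ((natDegree_mul_le.trans (Nat.add_le_add_right natDegree_X_le _)).trans_lt (by omega)),
    Finset.sum_range_succ', energy_eq P (Nat.lt_succ_self _)]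
  simp [coeff_X_mul]

lemma energy_X_pow_mul (n : ℕ) (P : R[X]) : energy (X ^ n * P) = energy P := by
  induction n with
  | zero => simp
  | succ n ih => rw [pow_succ', mul_assoc, energy_X_mul, ih]

lemma energy_C_mul (a : ℂ) (P : ℂ[X]) : energy (C a * P) = ‖a‖ ^ 2 * energy P := by
  rw [energy_eq (C a * P) ((natDegree_C_mul_le a P).trans_lt (Nat.lt_succ_self _)),
    energy_eq P (Nat.lt_succ_self _), Finset.mul_sum]
  simp [mul_pow]

/-- A polynomial with real coefficients, regarded as a complex polynomial. -/
noncomputable abbrev toComplex (p : ℝ[X]) : ℂ[X] := p.map Complex.ofRealHom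

lemma energy_toComplex_add (p q : ℝ[X]) :
    energy (toComplex p + C Complex.I * toComplex q) = energy p + energy q := by
  set S := toComplex p + C Complex.I * toComplex q
  have hN : ∃ N, p.natDegree < N ∧ q.natDegree < N ∧ S.natDegree < N :=
    ⟨p.natDegree + q.natDegree + S.natDegree + 1, by omega, by omega, by omega⟩
  obtain ⟨N, h1, h2, h3⟩ := hN
  rw [energy_eq p h1, energy_eq q h2, energy_eq S h3, ← Finset.sum_add_distrib]
  refine Finset.sum_congr rfl fun n _ => ?_
  have : S.coeff n = ⟨p.coeff n, q.coeff n⟩ := by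
    apply Complex.ext <;> simp [S, toComplex]
  rw [this, ← Complex.normSq_eq_norm_sq, Complex.normSq_mk]
  simp [sq]

lemma energy_toComplex (p : ℝ[X]) : energy (toComplex p) = energy p := by
  simpa [energy] using energy_toComplex_add p 0

lemma exists_eq_toComplex_add (P : ℂ[X]) :
    ∃ p q : ℝ[X], P = toComplex p + C Complex.I * toComplex q := by
  induction P using Polynomial.induction_on' with
  | add P Q hP hQ =>
    obtain ⟨p, q, rfl⟩ := hP
    obtain ⟨p', q', rfl⟩ := hQ
    exact ⟨p + p', q + q', by simp [toComplex]; ring⟩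
  | monomial n a =>
    refine ⟨monomial n a.re, monomial n a.im, ?_⟩
    rw [toComplex, toComplex, map_monomial, map_monomial, C_mul_monomial, ← map_add]
    congr 1
    simpa [mul_comm] using (Complex.re_add_im a).symm

/-- Reflecting the zero `w` of a polynomial at the unit circle does not change the energy: the
quotient `(X - w) / (1 - w̄ X)` is a Blaschke factor. -/
lemma energy_X_sub_C_mul (w : ℂ) (E : ℂ[X]) :
    energy ((X - C w) * E) = energy ((1 - C (conj w) * X) * E) := by
  have hd1 : ((X - C w) * E).natDegree < E.natDegree + 2 :=
    (natDegree_mul_le.trans (Nat.add_le_add_right (natDegree_X_sub_C_le w) _)).trans_lt (by omega)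
  have hd2 : ((1 - C (conj w) * X) * E).natDegree < E.natDegree + 2 := by
    refine (natDegree_mul_le.trans (Nat.add_le_add_right (m := 1) ?_ _)).trans_lt (by omega)
    compute_degree
  rw [energy_eq _ hd1, energy_eq _ hd2, Finset.sum_range_succ' _ (E.natDegree + 1),
    Finset.sum_range_succ' _ (E.natDegree + 1)]
  -- Termwise the two energies differ by a multiple of a telescoping sum.
  have key : ∀ x y : ℂ, ‖x - w * y‖ ^ 2 = ‖y - conj w * x‖ ^ 2 +
      (1 - ‖w‖ ^ 2) * (‖x‖ ^ 2 - ‖y‖ ^ 2) := by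
    intro x y
    simp only [← Complex.normSq_eq_norm_sq, Complex.normSq_apply, Complex.sub_re, Complex.sub_im,
      Complex.mul_re, Complex.mul_im, Complex.conj_re, Complex.conj_im]
    ring
  have h1 : ∀ n, ((X - C w) * E).coeff (n + 1) = E.coeff n - w * E.coeff (n + 1) := fun n => by
    simp [sub_mul, coeff_X_mul]
  have h2 : ∀ n, ((1 - C (conj w) * X) * E).coeff (n + 1) =
      E.coeff (n + 1) - conj w * E.coeff n := fun n => by
    simp [sub_mul, mul_assoc, coeff_X_mul]
  simp only [h1, h2, key, Finset.sum_add_distrib, ← Finset.mul_sum]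
  rw [Finset.sum_range_sub' fun n => ‖E.coeff n‖ ^ 2, coeff_eq_zero_of_natDegree_lt
    (Nat.lt_succ_self E.natDegree)]
  simp [sub_mul, mul_assoc]
  ring

/-! ### Zeros of a polynomial with extremal constant coefficient -/

/-- If the constant coefficient of `c` is as large as the energies of the multiples of `c` allow,
then `c` has no zero in the open unit disc: reflecting such a zero `w` would give every multiple
`c * p` with `p(0) = 1` the energy `|c(0)|² / |w|²` at least. -/
lemma eval_ne_zero_of_energy_lt {c : ℝ[X]} (h0 : c.coeff 0 ≠ 0)
    (hc : ∀ r, c.coeff 0 ^ 2 < r → ∃ p : ℝ[X], p.coeff 0 = 1 ∧ energy (c * p) < r)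
    {w : ℂ} (hw : ‖w‖ < 1) : (toComplex c).eval w ≠ 0 := by
  intro h
  obtain ⟨D, hD⟩ := dvd_iff_isRoot.2 h
  have hc0 : (c.coeff 0 : ℂ) = -w * D.coeff 0 := by
    have := congrArg (fun P => P.coeff 0) hD
    simpa [toComplex, mul_coeff_zero] using this
  have hn : c.coeff 0 ^ 2 = ‖w‖ ^ 2 * ‖D.coeff 0‖ ^ 2 := by
    rw [← mul_pow, ← norm_mul, ← norm_neg, ← neg_mul, ← hc0, Complex.norm_real, Real.norm_eq_abs,
      sq_abs]
  have hpos : 0 < c.coeff 0 ^ 2 := by positivity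
  have hlt : c.coeff 0 ^ 2 < ‖D.coeff 0‖ ^ 2 := by
    rw [hn] at hpos ⊢
    have hDpos : 0 < ‖D.coeff 0‖ ^ 2 := pos_of_mul_pos_right hpos (by positivity)
    exact mul_lt_of_lt_one_left hDpos (pow_lt_one₀ (norm_nonneg w) hw two_ne_zero)
  obtain ⟨p, hp0, hp⟩ := hc _ hlt
  refine hp.not_ge ?_
  rw [← energy_toComplex, toComplex, Polynomial.map_mul, ← toComplex, hD, mul_assoc,
    energy_X_sub_C_mul]
  refine le_trans (le_of_eq ?_) (norm_coeff_zero_sq_le_energy _)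
  simp [mul_coeff_zero, hp0]

/-- If multiplication by `c` is bounded below, then `c` has no zero on the unit circle: at such a
zero `w`, the energies of the products of `c` with the partial sums of `∑ (X / w)ᵏ` are bounded,
whereas the energies of these sums are not. -/
lemma eval_ne_zero_of_energy_bounded_below {c : ℝ[X]} {δ : ℝ} (hδ : 0 < δ)
    (hc : ∀ p : ℝ[X], δ * energy p ≤ energy (c * p)) {w : ℂ} (hw : ‖w‖ = 1) :
    (toComplex c).eval w ≠ 0 := by
  intro h
  obtain ⟨D, hD⟩ := dvd_iff_isRoot.2 h
  have hw0 : w ≠ 0 := by rintro rfl; simp at hw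
  have hcP : ∀ P : ℂ[X], δ * energy P ≤ energy (toComplex c * P) := by
    intro P
    obtain ⟨p, q, rfl⟩ := exists_eq_toComplex_add P
    rw [show toComplex c * (toComplex p + C Complex.I * toComplex q) =
      toComplex (c * p) + C Complex.I * toComplex (c * q) by simp [toComplex]; ring,
      energy_toComplex_add, energy_toComplex_add, mul_add]
    exact add_le_add (hc p) (hc q)
  have hbound : ∀ N : ℕ, δ * N ≤ 4 * energy D := by
    intro N
    set Y : ℂ[X] := C w⁻¹ * X with hY
    have hcoeff : ∀ k, Y ^ k = C (w⁻¹ ^ k) * X ^ k := fun k => by rw [hY, mul_pow, C_pow]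
    have hS : energy (∑ k ∈ Finset.range N, Y ^ k) = N := by
      have hco : ∀ n ∈ Finset.range N, (∑ k ∈ Finset.range N, Y ^ k).coeff n = w⁻¹ ^ n := by
        intro n hn
        rw [finsetSum_coeff, Finset.sum_eq_single n]
        · simp [hcoeff]
        · intro k _ hk
          simp [hcoeff, coeff_X_pow, hk.symm]
        · exact fun h => absurd hn h
      rcases Nat.eq_zero_or_pos N with rfl | hN
      · simp [energy]
      · rw [energy_eq _ (N := N), Finset.sum_congr rfl fun n hn => by rw [hco n hn]]
        · simp [hw]
        · refine (natDegree_sum_le_of_forall_le (n := N - 1) _ _ fun k hk => ?_).trans_lt (by omega)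
          rw [hcoeff]
          exact (natDegree_C_mul_X_pow_le _ _).trans (by have := Finset.mem_range.1 hk; omega)
    have hprod : toComplex c * ∑ k ∈ Finset.range N, Y ^ k =
        C (-w) * (D - C (w⁻¹ ^ N) * (X ^ N * D)) := by
      have h1 : X - C w = C (-w) * (1 - Y) := by
        rw [hY, mul_sub, ← mul_assoc, ← C_mul, neg_mul, mul_inv_cancel₀ hw0]
        simp; ring
      calc toComplex c * ∑ k ∈ Finset.range N, Y ^ k
          = C (-w) * D * ((1 - Y) * ∑ k ∈ Finset.range N, Y ^ k) := by rw [hD, h1]; ring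
        _ = C (-w) * (D - C (w⁻¹ ^ N) * (X ^ N * D)) := by
          rw [mul_neg_geom_sum, hcoeff]; ring
    have h2 := hcP (∑ k ∈ Finset.range N, Y ^ k)
    rw [hS, hprod, energy_C_mul] at h2
    have h3 := energy_sub_le D (C (w⁻¹ ^ N) * (X ^ N * D))
    rw [energy_C_mul, energy_X_pow_mul] at h3
    simp only [norm_neg, hw, norm_pow, norm_inv, inv_one, one_pow, one_mul] at h2 h3
    linarith
  obtain ⟨N, hN⟩ := exists_nat_gt (4 * energy D / δ)
  rw [div_lt_iff₀ hδ] at hN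
  have := hbound N
  linarith

/-! ### Uniqueness of the spectral factor without zeros in the disc -/

/-- The conjugate reciprocal polynomial with respect to the degree bound `m`. -/
noncomputable def conjReflect (m : ℕ) (P : ℂ[X]) : ℂ[X] :=
  (Polynomial.reflect m P).map (starRingEnd ℂ)

lemma eval_conjReflect {m : ℕ} {P : ℂ[X]} (hP : P.natDegree ≤ m) {w : ℂ} (hw : w ≠ 0) :
    (conjReflect m P).eval w = w ^ m * conj (P.eval (conj w)⁻¹) := by
  let _ : Invertible w⁻¹ := invertibleOfNonzero (inv_ne_zero hw)
  have h := eval₂_reflect_mul_pow (starRingEnd ℂ) w⁻¹ m P hP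
  rw [invOf_eq_inv, inv_inv] at h
  have h2 : eval₂ (starRingEnd ℂ) w⁻¹ P = conj (P.eval (conj w)⁻¹) := by
    rw [eval, hom_eval₂]
    simp
  rw [conjReflect, eval_map, ← h2, ← h, mul_comm, mul_assoc, ← mul_pow, inv_mul_cancel₀ hw, one_pow,
    mul_one]

lemma norm_eval_conjReflect {m : ℕ} {P : ℂ[X]} (hP : P.natDegree ≤ m) {w : ℂ} (hw : ‖w‖ = 1) :
    ‖(conjReflect m P).eval w‖ = ‖P.eval w‖ := by
  have hw0 : w ≠ 0 := by rintro rfl; simp at hw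
  have hinv : (conj w)⁻¹ = w := by
    rw [← Complex.inv_eq_conj hw, inv_inv]
  rw [eval_conjReflect hP hw0, hinv]
  simp [hw]

lemma conjReflect_X_sub_C_mul {m : ℕ} {P : ℂ[X]} (hP : P.natDegree ≤ m) (w : ℂ) :
    conjReflect (m + 1) ((X - C w) * P) = (1 - C (conj w) * X) * conjReflect m P := by
  rw [conjReflect, add_comm m 1, reflect_mul _ _ (natDegree_X_sub_C_le w) hP, Polynomial.map_mul,
    reflect_sub, reflect_one_X, reflect_C]
  simp [conjReflect]

/-- A zero `w` of `P` is one of `Q` or of its conjugate reciprocal. The latter vanishes at `w` only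
if `Q` vanishes at `1 / w̄`, which lies in the open disc or is `w` itself. -/
lemma isRoot_of_mul_conjReflect_eq {m : ℕ} {P Q : ℂ[X]} (hQm : Q.natDegree ≤ m)
    (hP : ∀ w, ‖w‖ < 1 → P.eval w ≠ 0) (hQ : ∀ w, ‖w‖ < 1 → Q.eval w ≠ 0)
    (h : P * conjReflect m P = Q * conjReflect m Q) {w : ℂ} (hw : P.eval w = 0) :
    Q.eval w = 0 := by
  have hw1 : 1 ≤ ‖w‖ := not_lt.1 fun h => hP w h hw
  have hw0 : w ≠ 0 := by rintro rfl; simp at hw1; linarith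
  have he := congrArg (eval w) h
  rw [eval_mul, eval_mul, hw, zero_mul, eq_comm, mul_eq_zero] at he
  rcases he with h2 | h2
  · exact h2
  rcases hw1.eq_or_lt with h1 | h1
  · rw [← norm_eq_zero, ← norm_eval_conjReflect hQm h1.symm, h2, norm_zero]
  · rw [eval_conjReflect hQm hw0, mul_eq_zero, map_eq_zero] at h2
    refine (h2.elim (pow_ne_zero m hw0) (hQ _ ?_)).elim
    rw [norm_inv, RCLike.norm_conj]
    exact inv_lt_one_of_one_lt₀ h1

/-- A polynomial without zeros in the open unit disc is determined, up to a constant factor, by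
its product with its conjugate reciprocal. Zeros are removed one at a time: each zero of one
polynomial is a zero of the other. -/
lemma eq_C_mul_of_mul_conjReflect_eq (m : ℕ) {P Q : ℂ[X]} (hPm : P.natDegree ≤ m)
    (hQm : Q.natDegree ≤ m) (hP : ∀ w, ‖w‖ < 1 → P.eval w ≠ 0)
    (hQ : ∀ w, ‖w‖ < 1 → Q.eval w ≠ 0) (h : P * conjReflect m P = Q * conjReflect m Q) :
    ∃ a : ℂ, Q = C a * P := by
  induction m generalizing P Q with
  | zero =>
    rw [eq_C_of_natDegree_le_zero hPm, eq_C_of_natDegree_le_zero hQm]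
    have hP0 : P.coeff 0 ≠ 0 := by simpa [coeff_zero_eq_eval_zero] using hP 0 (by simp)
    exact ⟨Q.coeff 0 / P.coeff 0, by rw [← C_mul, div_mul_cancel₀ _ hP0]⟩
  | succ m ih =>
    by_cases hroot : ∃ w, P.eval w = 0 ∧ Q.eval w = 0
    · obtain ⟨w, hPw, hQw⟩ := hroot
      obtain ⟨P', rfl⟩ := dvd_iff_isRoot.2 hPw
      obtain ⟨Q', rfl⟩ := dvd_iff_isRoot.2 hQw
      have hne : X - C w ≠ 0 := X_sub_C_ne_zero w
      have hne' : (1 - C (conj w) * X : ℂ[X]) ≠ 0 := fun h0 => by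
        simpa using congrArg (fun P => P.coeff 0) h0
      have hdeg : ∀ R : ℂ[X], R ≠ 0 → ((X - C w) * R).natDegree ≤ m + 1 → R.natDegree ≤ m :=
        fun R hR h => by
          rw [natDegree_mul hne hR, natDegree_X_sub_C] at h; omega
      have hP' : ∀ u, ‖u‖ < 1 → P'.eval u ≠ 0 := fun u hu h0 => hP u hu (by simp [h0])
      have hQ' : ∀ u, ‖u‖ < 1 → Q'.eval u ≠ 0 := fun u hu h0 => hQ u hu (by simp [h0])
      have hPd := hdeg P' (fun h0 => hP' 0 (by simp) (by simp [h0])) hPm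
      have hQd := hdeg Q' (fun h0 => hQ' 0 (by simp) (by simp [h0])) hQm
      rw [conjReflect_X_sub_C_mul hPd, conjReflect_X_sub_C_mul hQd] at h
      obtain ⟨a, rfl⟩ := ih hPd hQd hP' hQ'
        (mul_left_cancel₀ (mul_ne_zero hne hne') (by linear_combination h))
      exact ⟨a, by ring⟩
    · have hPr : ∀ w, P.eval w ≠ 0 := fun w hw =>
        hroot ⟨w, hw, isRoot_of_mul_conjReflect_eq hQm hP hQ h hw⟩
      have hQr : ∀ w, Q.eval w ≠ 0 := fun w hw =>
        hroot ⟨w, isRoot_of_mul_conjReflect_eq hPm hQ hP h.symm hw, hw⟩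
      have hconst : ∀ R : ℂ[X], (∀ w, R.eval w ≠ 0) → R = C (R.coeff 0) := fun R hR =>
        eq_C_of_degree_le_zero (not_lt.1 fun hd =>
          let ⟨w, hw⟩ := Complex.exists_root hd
          hR w hw)
      rw [hconst P hPr, hconst Q hQr]
      have hP0 : P.coeff 0 ≠ 0 := by simpa [coeff_zero_eq_eval_zero] using hPr 0
      exact ⟨Q.coeff 0 / P.coeff 0, by rw [← C_mul, div_mul_cancel₀ _ hP0]⟩

/-! ### Toeplitz forms as energies -/

lemma sum_shift_mul_shift {c : ℕ → ℝ} {M : ℕ} (hc : ∀ n, M ≤ n → c n = 0) {a b L : ℕ}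
    (hab : a ≤ b) (hL : b + M ≤ L) :
    ∑ m ∈ Finset.range L, (if a ≤ m then c (m - a) else 0) * (if b ≤ m then c (m - b) else 0) =
      ∑ s ∈ Finset.range M, c s * c (s + (b - a)) := by
  obtain ⟨r, rfl⟩ := Nat.exists_eq_add_of_le hL
  rw [add_assoc, Finset.sum_range_add _ b, Finset.sum_eq_zero (s := Finset.range b), zero_add,
    Finset.sum_range_add, Finset.sum_eq_zero (s := Finset.range r), add_zero]
  · refine Finset.sum_congr rfl fun s _ => ?_
    rw [if_pos (by omega), if_pos (by omega), mul_comm, show b + s - a = s + (b - a) by omega,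
      show b + s - b = s by omega]
  · intro s _
    rw [hc (b + (M + s) - b) (by omega), ite_self, mul_zero]
  · intro m hm
    rw [if_neg (show ¬ b ≤ m by simpa using hm), mul_zero]

/-- The Toeplitz form of the autocorrelation of `c` is the energy of the filtered sequence. -/
lemma qform_eq_energy {A : ℕ → ℕ → ℝ} (hA : ∀ a b, A a b = A b a)
    (hT : ∀ a b, A (a + 1) (b + 1) = A a b) {c : ℝ[X]} {M : ℕ} (hc : ∀ n, M ≤ n → c.coeff n = 0)
    (hcA : ∀ d, ∑ s ∈ Finset.range M, c.coeff s * c.coeff (s + d) = A 0 d) {p : ℝ[X]} {n : ℕ}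
    (hp : p.natDegree < n) : qform A n p.coeff = energy (c * p) := by
  have hdeg : (c * p).natDegree < n + M := by
    refine natDegree_mul_le.trans_lt ?_
    have : c.natDegree ≤ M := natDegree_le_iff_coeff_eq_zero.2 fun k hk => hc k hk.le
    omega
  have hcoeff : ∀ m, (c * p).coeff m =
      ∑ a ∈ Finset.range n, p.coeff a * if a ≤ m then c.coeff (m - a) else 0 := by
    intro m
    conv_lhs => rw [p.as_sum_range' n hp, Finset.mul_sum, finsetSum_coeff]
    refine Finset.sum_congr rfl fun a _ => ?_
    rw [← C_mul_X_pow_eq_monomial, ← mul_assoc, coeff_mul_X_pow']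
    split_ifs <;> simp [mul_comm]
  have hsum : ∀ a b, a ≤ b → b < n → ∑ m ∈ Finset.range (n + M),
      (if a ≤ m then c.coeff (m - a) else 0) * (if b ≤ m then c.coeff (m - b) else 0) = A a b := by
    intro a b hab hb
    rw [sum_shift_mul_shift hc hab (by omega), hcA, ← toeplitz_add hT a 0 (b - a)]
    congr 1; omega
  rw [energy_eq _ hdeg]
  simp only [hcoeff, Real.norm_eq_abs, sq_abs]
  simp only [sq, Finset.sum_mul_sum]
  rw [Finset.sum_comm, qform]
  refine Finset.sum_congr rfl fun a ha => ?_
  rw [Finset.sum_comm]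
  refine Finset.sum_congr rfl fun b hb => ?_
  rw [Finset.mem_range] at ha hb
  have : A a b = ∑ m ∈ Finset.range (n + M),
      (if a ≤ m then c.coeff (m - a) else 0) * (if b ≤ m then c.coeff (m - b) else 0) := by
    rcases le_total a b with h | h
    · exact (hsum a b h hb).symm
    · rw [hA, ← hsum b a h ha]
      exact Finset.sum_congr rfl fun _ _ => mul_comm _ _
  rw [this, Finset.mul_sum]
  exact Finset.sum_congr rfl fun _ _ => by ring

lemma qform_reverse {A : ℕ → ℕ → ℝ} (hA : ∀ a b, A a b = A b a)
    (hT : ∀ a b, A (a + 1) (b + 1) = A a b) (n : ℕ) (x : ℕ → ℝ) :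
    qform A (n + 1) (fun a => x (n - a)) = qform A (n + 1) x := by
  have hAd : ∀ a b, a ≤ b → A a b = A 0 (b - a) := fun a b h => by
    rw [← toeplitz_add hT a 0 (b - a)]; congr 1; omega
  unfold qform
  rw [← Finset.sum_range_reflect]
  refine Finset.sum_congr rfl fun a ha => ?_
  rw [← Finset.sum_range_reflect]
  refine Finset.sum_congr rfl fun b hb => ?_
  rw [Finset.mem_range] at ha hb
  have : A (n + 1 - 1 - a) (n + 1 - 1 - b) = A a b := by
    rcases le_total a b with h | h
    · rw [hA, hAd a b h, hAd _ _ (by omega)]; congr 1; omega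
    · rw [hA a b, hAd b a h, hAd _ _ (by omega)]; congr 1; omega
  simp only [this]
  rw [show n - (n + 1 - 1 - a) = a by omega, show n - (n + 1 - 1 - b) = b by omega]

/-- The limit of the Cholesky rows of a banded Toeplitz kernel is a minimum phase spectral factor;
its zeros avoid the circle if the kernel is bounded below. -/
lemma exists_limit_spectralFactor {A : ℕ → ℕ → ℝ} (hA : IsPosDefKernel A)
    (hT : ∀ a b, A (a + 1) (b + 1) = A a b) {M : ℕ} (hM : ∀ a b, a + M ≤ b → A a b = 0) :
    ∃ c : ℝ[X], (∀ k, Tendsto (fun i => chol A i (i + k)) atTop (𝓝 (c.coeff k))) ∧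
      (∀ n, M ≤ n → c.coeff n = 0) ∧ 0 < c.coeff 0 ∧
      (∀ d, ∑ s ∈ Finset.range M, c.coeff s * c.coeff (s + d) = A 0 d) ∧
      (∀ w : ℂ, ‖w‖ < 1 → (toComplex c).eval w ≠ 0) ∧
      ((∃ δ > 0, ∀ n x, δ * ∑ a ∈ Finset.range n, x a ^ 2 ≤ qform A n x) →
        ∀ w : ℂ, ‖w‖ = 1 → (toComplex c).eval w ≠ 0) := by
  obtain ⟨c', hc'0, hc'⟩ := exists_tendsto_chol hA hT hM
  have hband : ∀ n, M ≤ n → c' n = 0 := fun n hn =>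
    tendsto_nhds_unique (hc' n) (tendsto_const_nhds.congr fun i =>
      (chol_eq_zero_of_band hM (by omega)).symm)
  obtain ⟨c, hcc⟩ : ∃ c : ℝ[X], ∀ n, c.coeff n = c' n := by
    refine ⟨∑ n ∈ Finset.range M, monomial n (c' n), fun n => ?_⟩
    simp only [finsetSum_coeff, coeff_monomial, Finset.sum_ite_eq', Finset.mem_range]
    split_ifs with h
    · rfl
    · exact (hband n (not_lt.1 h)).symm
  obtain rfl : c' = c.coeff := funext fun n => (hcc n).symm
  have hcor := autocorrelation_of_tendsto hA hT hM hc'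
  refine ⟨c, hc', hband, hc'0, hcor, fun w hw => ?_, ?_⟩
  · refine eval_ne_zero_of_energy_lt hc'0.ne' (fun r hr => ?_) hw
    obtain ⟨n, x, hx, hq⟩ := exists_qform_lt hA (hc' 0) hr
    -- The one is the last entry of `x` but has to be the constant coefficient of `p`.
    let p : ℝ[X] := ∑ a ∈ Finset.range (n + 1), monomial a (x (n - a))
    have hpc : ∀ a < n + 1, p.coeff a = x (n - a) := fun a ha => by
      simp [p, coeff_monomial, ha]
    have hpd : p.natDegree < n + 1 := by
      refine (natDegree_sum_le_of_forall_le (n := n) _ _ fun a ha => ?_).trans_lt (by omega)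
      exact (natDegree_monomial_le _).trans (by have := Finset.mem_range.1 ha; omega)
    refine ⟨p, by rw [hpc 0 (by omega)]; exact hx, ?_⟩
    rw [← qform_eq_energy hA.symm hT hband hcor hpd]
    refine lt_of_eq_of_lt ?_ hq
    rw [← qform_reverse hA.symm hT n x]
    refine Finset.sum_congr rfl fun a ha => Finset.sum_congr rfl fun b hb => ?_
    rw [hpc a (Finset.mem_range.1 ha), hpc b (Finset.mem_range.1 hb)]
  · rintro ⟨δ, hδ, hb⟩ w hw
    refine eval_ne_zero_of_energy_bounded_below hδ (fun p => ?_) hw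
    have := hb (p.natDegree + 1) p.coeff
    rw [← qform_eq_energy hA.symm hT hband hcor (Nat.lt_succ_self _),
      energy_eq p (Nat.lt_succ_self _)]
    simpa using this

end Energy

/-! ### Filters as polynomials -/

section Taps

open Polynomial

lemma tap_of_lt {N : ℕ} (h : Fin N → ℝ) {n : ℕ} (hn : n < N) : tap h n = h ⟨n, hn⟩ := by
  simp [tap, hn]

lemma tap_eq_zero {N : ℕ} (h : Fin N → ℝ) {n : ℤ} (hn : n < 0 ∨ N ≤ n) : tap h n = 0 := by
  rw [tap, dif_neg (by omega)]

lemma tap_reflect {N : ℕ} (h : Fin N → ℝ) (n : ℤ) : tap (reflect h) n = tap h (N - 1 - n) := by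
  by_cases hn : 0 ≤ n ∧ n < N
  · rw [tap, tap, dif_pos hn, dif_pos (by omega), reflect]
    congr 1
    ext
    simp only [Fin.val_rev]
    omega
  · rw [tap_eq_zero _ (by omega), tap_eq_zero _ (by omega)]

/-- The polynomial in `z⁻¹` whose coefficients are the taps of the filter. -/
noncomputable def toPoly {N : ℕ} (h : Fin N → ℝ) : ℝ[X] := ∑ n : Fin N, monomial (n : ℕ) (h n)

lemma coeff_toPoly {N : ℕ} (h : Fin N → ℝ) (n : ℕ) : (toPoly h).coeff n = tap h n := by
  simp only [toPoly, finsetSum_coeff, coeff_monomial]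
  by_cases hn : n < N
  · rw [tap_of_lt h hn, Finset.sum_eq_single ⟨n, hn⟩]
    · simp
    · intro b _ hb
      exact if_neg fun h => hb (Fin.ext h)
    · simp
  · rw [tap_eq_zero h (by omega)]
    exact Finset.sum_eq_zero fun b _ => if_neg (by omega)

lemma natDegree_toPoly_le {N m : ℕ} (h : Fin N → ℝ) (hm : N ≤ m + 1) :
    (toPoly h).natDegree ≤ m :=
  natDegree_le_iff_coeff_eq_zero.2 fun n hn => by
    rw [coeff_toPoly, tap_eq_zero h (by omega)]

lemma zTransform_eq_eval {N : ℕ} (h : Fin N → ℝ) (z : ℂ) :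
    zTransform h z = (toComplex (toPoly h)).eval z⁻¹ := by
  simp [zTransform, toPoly, toComplex, Polynomial.map_sum, eval_finsetSum]

lemma toPoly_reflect {m : ℕ} (h : Fin (m + 1) → ℝ) :
    toPoly (reflect h) = Polynomial.reflect m (toPoly h) := by
  ext n
  rw [coeff_reflect, coeff_toPoly, coeff_toPoly, tap_reflect]
  rcases le_or_gt n m with hn | hn
  · rw [revAt_le hn]; congr 1; omega
  · rw [revAt_eq_self_of_lt hn, tap_eq_zero _ (by omega), tap_eq_zero _ (by omega)]

lemma toComplex_toPoly_reflect {m : ℕ} (h : Fin (m + 1) → ℝ) :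
    toComplex (toPoly (reflect h)) = conjReflect m (toComplex (toPoly h)) := by
  rw [toPoly_reflect, conjReflect, toComplex, toComplex, reflect_map, Polynomial.map_map]
  congr 1
  ext x
  simp

/-- The factorization on the `Z` domain is one of polynomials in `z⁻¹`. -/
lemma isSpectralFactor_iff_toPoly {M : ℕ} (c : Fin M → ℝ) (g : Fin (2 * M - 1) → ℝ) :
    IsSpectralFactor c g ↔ toPoly g = toPoly c * toPoly (reflect c) := by
  have hev : ∀ z : ℂ, zTransform c z * zTransform (reflect c) z =
      (toComplex (toPoly c * toPoly (reflect c))).eval z⁻¹ := fun z => by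
    simp [zTransform_eq_eval, toComplex]
  constructor
  · intro h
    refine Polynomial.map_injective Complex.ofRealHom Complex.ofRealHom.injective ?_
    refine Polynomial.eq_of_infinite_eval_eq _ _ ((Set.finite_singleton 0).infinite_compl.mono ?_)
    intro w hw
    have := h w⁻¹ (inv_ne_zero hw)
    rwa [hev, zTransform_eq_eval, inv_inv] at this
  · intro h z _
    rw [hev, ← h, zTransform_eq_eval]

/-- Both sides are symmetric about the centre, so that the Orchard–Wilson equations, which
compare one half of the coefficients, determine all of them. -/
lemma solvesOrchardWilson_iff_toPoly {M : ℕ} (hM : 0 < M) (c : Fin M → ℝ)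
    {g : Fin (2 * M - 1) → ℝ} (hg : IsLinearPhase g) :
    SolvesOrchardWilson c g ↔ toPoly g = toPoly c * toPoly (reflect c) := by
  obtain ⟨m, rfl⟩ := Nat.exists_eq_add_one_of_ne_zero hM.ne'
  have hlow : ∀ k, k ≤ m → (toPoly c * toPoly (reflect c)).coeff (m - k) =
      ∑ i ∈ Finset.range (m + 1 - k), tap c i * tap c (i + (k : ℕ)) := by
    intro k hk
    rw [coeff_mul, Finset.Nat.sum_antidiagonal_eq_sum_range_succ_mk,
      show (m - k).succ = m + 1 - k by omega]
    refine Finset.sum_congr rfl fun i hi => ?_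
    have := Finset.mem_range.1 hi
    simp only [coeff_toPoly, tap_reflect]
    congr 2; omega
  have hsym : ∀ k, k ≤ m → (toPoly c * toPoly (reflect c)).coeff (m + k) =
      (toPoly c * toPoly (reflect c)).coeff (m - k) := by
    intro k hk
    have h : Polynomial.reflect (m + m) (toPoly c * toPoly (reflect c)) =
        toPoly c * toPoly (reflect c) := by
      rw [reflect_mul _ _ (natDegree_toPoly_le c le_rfl) (natDegree_toPoly_le _ le_rfl),
        toPoly_reflect, reflect_reflect, mul_comm]
    conv_lhs => rw [← h, coeff_reflect, revAt_le (by omega)]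
    congr 1; omega
  have hgsym : ∀ n : ℤ, tap g n = tap g (2 * m - n) := by
    intro n
    conv_lhs => rw [← hg, tap_reflect]
    congr 1; omega
  constructor
  · intro h
    have hle : ∀ k, k ≤ m → (toPoly g).coeff (m - k) =
        (toPoly c * toPoly (reflect c)).coeff (m - k) := by
      intro k hk
      have := h ⟨k, by omega⟩
      rw [hlow k hk, this, coeff_toPoly]
      congr 1
      push_cast [hk]; ring
    ext n
    rcases le_total n m with hn | hn
    · simpa [Nat.sub_sub_self hn] using hle (m - n) (by omega)
    · obtain ⟨k, rfl⟩ := Nat.exists_eq_add_of_le hn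
      rcases le_or_gt k m with hk | hk
      · rw [hsym k hk, ← hle k hk, coeff_toPoly, coeff_toPoly, hgsym]
        congr 1
        push_cast [hk]; ring
      · rw [coeff_toPoly, tap_eq_zero g (by omega), coeff_eq_zero_of_natDegree_lt]
        exact (natDegree_mul_le_of_le (natDegree_toPoly_le c le_rfl)
          (natDegree_toPoly_le (reflect c) le_rfl)).trans_lt (by omega)
  · intro h k
    have hk : (k : ℕ) ≤ m := by omega
    rw [← hlow k hk, ← h, coeff_toPoly]
    congr 1
    push_cast [hk]; ring

end Taps

/-! ### The Toeplitz kernel of a linear phase filter -/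

section Kernel

variable {M : ℕ}

/-- The Toeplitz kernel on `ℕ` whose leading blocks are the banded Toeplitz matrices of `g`. -/
def kernel (g : Fin (2 * M - 1) → ℝ) (a b : ℕ) : ℝ := tap g ((M : ℤ) - 1 + ((b : ℤ) - a))

lemma tap_lift (hM : 0 < M) (g : Fin (2 * M - 1) → ℝ) (γ : ℝ) (n : ℤ) :
    tap (lift g γ) n = tap g n + if n = M - 1 then γ else 0 := by
  by_cases hn : 0 ≤ n ∧ n < (2 * M - 1 : ℕ)
  · rw [tap, tap, dif_pos hn, dif_pos hn, lift]
    congr 1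
    refine if_congr ?_ rfl rfl
    simp only
    omega
  · rw [tap_eq_zero _ (by omega), tap_eq_zero _ (by omega), if_neg (by omega), add_zero]

lemma gramianAdj_apply (hM : 0 < M) (g : Fin (2 * M - 1) → ℝ) (γ : ℝ) (Q : ℕ)
    (i j : Fin (2 * Q + M)) : gramianAdj g γ Q i j = kernel (lift g γ) i j := by
  rw [kernel, tap_lift hM]
  simp only [gramianAdj, gramian, Matrix.add_apply, Matrix.of_apply, Matrix.smul_apply,
    Matrix.one_apply, smul_eq_mul, mul_ite, mul_one, mul_zero]
  congr 1
  refine if_congr ?_ rfl rfl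
  rw [Fin.ext_iff]
  omega

lemma IsLinearPhase.lift {g : Fin (2 * M - 1) → ℝ} (hg : IsLinearPhase g) (γ : ℝ) :
    IsLinearPhase (lift g γ) := by
  ext n
  have h := congrFun hg n
  simp only [reflect, FIR.lift] at h ⊢
  rw [h]
  congr 1
  refine if_congr ?_ rfl rfl
  rw [Fin.val_rev]
  omega

lemma kernel_symm {g : Fin (2 * M - 1) → ℝ} (hg : IsLinearPhase g) (a b : ℕ) :
    kernel g a b = kernel g b a := by
  rw [kernel, kernel, ← hg, tap_reflect, hg]
  rcases Nat.eq_zero_or_pos M with rfl | hM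
  · rw [tap, tap, dif_neg (by omega), dif_neg (by omega)]
  · congr 1; omega

lemma kernel_succ (g : Fin (2 * M - 1) → ℝ) (a b : ℕ) :
    kernel g (a + 1) (b + 1) = kernel g a b := by
  rw [kernel, kernel]; congr 1; push_cast; ring

lemma kernel_band (g : Fin (2 * M - 1) → ℝ) (a b : ℕ) (h : a + M ≤ b) : kernel g a b = 0 :=
  tap_eq_zero g (by omega)

lemma dotProduct_gramianAdj (hM : 0 < M) (g : Fin (2 * M - 1) → ℝ) (γ : ℝ) {Q n : ℕ}
    (hn : n ≤ 2 * Q + M) (x : ℕ → ℝ) :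
    (fun a : Fin (2 * Q + M) => if (a : ℕ) < n then x a else 0) ⬝ᵥ
      ((gramianAdj g γ Q).mulVec fun a => if (a : ℕ) < n then x a else 0) =
      qform (kernel (lift g γ)) n x := by
  have hs : ∀ f : ℕ → ℝ, (∀ a, n ≤ a → f a = 0) →
      ∑ a : Fin (2 * Q + M), f a = ∑ a ∈ Finset.range n, f a := fun f hf => by
    rw [← Finset.sum_range f]
    refine (Finset.sum_subset (Finset.range_mono hn) fun a _ ha => hf a ?_).symm
    simpa using ha
  simp only [dotProduct, Matrix.mulVec, gramianAdj_apply hM]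
  rw [hs (fun a => (if a < n then x a else 0) * ∑ b : Fin (2 * Q + M),
    kernel (lift g γ) a b * if (b : ℕ) < n then x b else 0)
    fun a ha => by rw [if_neg (by omega), zero_mul]]
  refine Finset.sum_congr rfl fun a ha => ?_
  rw [hs (fun b => kernel (lift g γ) a b * if b < n then x b else 0)
    fun b hb => by rw [if_neg (by omega), mul_zero], Finset.mul_sum]
  refine Finset.sum_congr rfl fun b hb => ?_
  rw [if_pos (Finset.mem_range.1 ha), if_pos (Finset.mem_range.1 hb)]
  ring

lemma isPosDefKernel (hM : 0 < M) {g : Fin (2 * M - 1) → ℝ} (hg : IsLinearPhase g) {γ : ℝ}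
    (hpos : ∀ Q : ℕ, (gramianAdj g γ Q).PosDef) : IsPosDefKernel (kernel (lift g γ)) where
  symm := kernel_symm (hg.lift γ)
  pos n x := by
    rintro ⟨a, ha, hxa⟩
    rw [← dotProduct_gramianAdj hM g γ (show n ≤ 2 * n + M by omega)]
    refine (hpos n).dotProduct_mulVec_pos fun h => hxa ?_
    have h' : (if a < n then x a else 0) = 0 := congrFun h ⟨a, by omega⟩
    rwa [if_pos ha] at h'

/-- A uniform lower bound for the eigenvalues is one for the Toeplitz forms. -/
lemma le_qform_of_le_eigenvalues (hM : 0 < M) (g : Fin (2 * M - 1) → ℝ) {γ : ℝ}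
    (hpos : ∀ Q : ℕ, (gramianAdj g γ Q).PosDef) {δ : ℝ}
    (hδ : ∀ (Q : ℕ) (i : Fin (2 * Q + M)), δ ≤ (hpos Q).isHermitian.eigenvalues i)
    (n : ℕ) (x : ℕ → ℝ) :
    δ * ∑ a ∈ Finset.range n, x a ^ 2 ≤ qform (kernel (lift g γ)) n x := by
  have hpsd : (gramianAdj g γ n - δ • 1).PosSemidef := by
    set hH := (hpos n).isHermitian
    have heq : gramianAdj g γ n - δ • 1 = Unitary.conjStarAlgAut ℝ _ hH.eigenvectorUnitary
        (Matrix.diagonal fun i => hH.eigenvalues i - δ) := by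
      conv_lhs => rw [hH.spectral_theorem]
      rw [← map_one (Unitary.conjStarAlgAut ℝ _ hH.eigenvectorUnitary), ← map_smul, ← map_sub]
      congr 1
      rw [← Matrix.diagonal_one, ← Matrix.diagonal_smul, Matrix.diagonal_sub]
      simp
    rw [heq, Unitary.conjStarAlgAut_apply]
    refine Matrix.PosSemidef.mul_mul_conjTranspose_same (Matrix.PosSemidef.diagonal ?_) _
    exact fun i => sub_nonneg.2 (hδ n i)
  set v : Fin (2 * n + M) → ℝ := fun a => if (a : ℕ) < n then x a else 0
  have h := hpsd.dotProduct_mulVec_nonneg v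
  have hv : v ⬝ᵥ v = ∑ a ∈ Finset.range n, x a ^ 2 := by
    simp only [dotProduct, v]
    rw [← Finset.sum_range fun a => (if a < n then x a else 0) * if a < n then x a else 0]
    rw [← Finset.sum_subset (Finset.range_mono (show n ≤ 2 * n + M by omega))
      fun a _ ha => by simp [show ¬ a < n by simpa using ha]]
    exact Finset.sum_congr rfl fun a ha => by rw [if_pos (Finset.mem_range.1 ha), sq]
  rw [Matrix.sub_mulVec, Matrix.smul_mulVec, Matrix.one_mulVec, star_trivial, dotProduct_sub,
    dotProduct_smul, smul_eq_mul, hv, dotProduct_gramianAdj hM g γ (by omega)] at h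
  linarith

/-- The Cholesky factor of a leading block is the leading block of the infinite factor. -/
lemma isCholeskyFactor_iff (hM : 0 < M) {g : Fin (2 * M - 1) → ℝ} {γ : ℝ}
    (hA : IsPosDefKernel (kernel (lift g γ))) (Q : ℕ)
    (C : Matrix (Fin (2 * Q + M)) (Fin (2 * Q + M)) ℝ) :
    IsCholeskyFactor (gramianAdj g γ Q) C ↔ ∀ i j, C i j = chol (kernel (lift g γ)) i j := by
  constructor
  · intro h
    have key : ∀ n (hn : n < 2 * Q + M) j, C ⟨n, hn⟩ j = chol (kernel (lift g γ)) n j := by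
      intro n
      induction n using Nat.strong_induction_on with
      | _ n ih =>
        intro hn j
        set i : Fin (2 * Q + M) := ⟨n, hn⟩
        -- Row `i` is determined by the rows above it.
        have hrow : ∀ l : Fin (2 * Q + M), C i i * C i l = schur (kernel (lift g γ)) n n l := by
          intro l
          let f : ℕ → ℝ := fun k => if k < n then
            chol (kernel (lift g γ)) k n * chol (kernel (lift g γ)) k l else
            if k = n then C i i * C i l else 0
          have hf : ∀ k : Fin (2 * Q + M), C k i * C k l = f k := by
            intro k
            rcases lt_trichotomy (k : ℕ) n with hk | hk | hk
            · rw [← Fin.eta k k.2, ih k hk, ih k hk]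
              simp [f, hk, i]
            · obtain rfl : k = i := Fin.ext hk
              simp [f, i]
            · rw [h.upper k i hk]
              simp [f, hk.not_gt, hk.ne']
          have hsum : kernel (lift g γ) n l = ∑ k ∈ Finset.range (n + 1), f k := by
            calc kernel (lift g γ) n l = ∑ k : Fin (2 * Q + M), C k i * C k l := by
                  rw [← gramianAdj_apply hM g γ Q i l, h.factor]; rfl
              _ = ∑ k ∈ Finset.range (2 * Q + M), f k := by
                  rw [Finset.sum_range]; exact Finset.sum_congr rfl fun k _ => hf k
              _ = ∑ k ∈ Finset.range (n + 1), f k := by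
                  refine (Finset.sum_subset (Finset.range_mono hn) fun k _ hk => ?_).symm
                  rw [Finset.mem_range, not_lt] at hk
                  simp [f, show ¬ k < n by omega, show k ≠ n by omega]
          have hlt : ∀ k ∈ Finset.range n, f k =
              chol (kernel (lift g γ)) k n * chol (kernel (lift g γ)) k l :=
            fun k hk => if_pos (Finset.mem_range.1 hk)
          rw [schur, hsum, Finset.sum_range_succ, Finset.sum_congr rfl hlt]
          simp [f]
        rcases lt_or_ge (j : ℕ) n with hj | hj
        · rw [h.upper i j hj, chol_of_lt hj]
        · have hd : √(schur (kernel (lift g γ)) n n n) = C i i := by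
            rw [← hrow i, Real.sqrt_mul_self (h.diag_pos i).le]
          rw [chol_of_le hj, hd, ← hrow j, mul_div_cancel_left₀ _ (h.diag_pos i).ne']
    exact fun i j => key i i.2 j
  · intro h
    refine ⟨fun i j hij => ?_, fun i => ?_, ?_⟩
    · rw [h, chol_of_lt hij]
    · rw [h]; exact hA.chol_diag_pos i
    · ext i j
      rw [gramianAdj_apply hM, hA.eq_sum_chol i.2, Finset.sum_range, Matrix.mul_apply]
      simp [h]

end Kernel

/-! ### Magnitude response and uniqueness -/

/-- On the unit circle the product of a filter with its reflection has the squared magnitude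
response as its modulus, so that the product determines the magnitude response. -/
lemma norm_zTransform_eq {M : ℕ} (hM : 0 < M) {c h : Fin M → ℝ}
    (hch : toPoly c * toPoly (reflect c) = toPoly h * toPoly (reflect h))
    {z : ℂ} (hz : ‖z⁻¹‖ = 1) : ‖zTransform c z‖ = ‖zTransform h z‖ := by
  obtain ⟨m, rfl⟩ := Nat.exists_eq_add_one_of_ne_zero hM.ne'
  have key : ∀ f : Fin (m + 1) → ℝ, ‖zTransform f z‖ ^ 2 =
      ‖(toComplex (toPoly f * toPoly (reflect f))).eval z⁻¹‖ := by
    intro f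
    rw [toComplex, Polynomial.map_mul, ← toComplex, ← toComplex,
      toComplex_toPoly_reflect, Polynomial.eval_mul, norm_mul,
      norm_eval_conjReflect (Polynomial.natDegree_map_le.trans (natDegree_toPoly_le f le_rfl)) hz,
      zTransform_eq_eval, sq]
  rw [← sq_eq_sq₀ (norm_nonneg _) (norm_nonneg _), key, key, hch]

/-- Two minimum phase filters with the same autocorrelation agree up to the sign. -/
lemma eq_or_eq_neg_of_isMinimumPhase {M : ℕ} (hM : 0 < M) {c c' : Fin M → ℝ}
    (hc : IsMinimumPhase c) (hc' : IsMinimumPhase c')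
    (h : toPoly c * toPoly (reflect c) =
      toPoly c' * toPoly (reflect c')) : c' = c ∨ c' = -c := by
  obtain ⟨m, rfl⟩ := Nat.exists_eq_add_one_of_ne_zero hM.ne'
  have hdisc : ∀ f : Fin (m + 1) → ℝ, IsMinimumPhase f →
      ∀ w : ℂ, ‖w‖ < 1 → (toComplex (toPoly f)).eval w ≠ 0 := by
    intro f hf w hw
    rcases eq_or_ne w 0 with rfl | hw0
    · rw [← Polynomial.coeff_zero_eq_eval_zero, Polynomial.coeff_map, coeff_toPoly]
      simpa using hf.1
    · have := hf.2 w⁻¹ (by rw [norm_inv]; exact (one_lt_inv₀ (norm_pos_iff.2 hw0)).2 hw)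
      rwa [zTransform_eq_eval, inv_inv] at this
  have hdeg : ∀ f : Fin (m + 1) → ℝ, (toComplex (toPoly f)).natDegree ≤ m := fun f =>
    Polynomial.natDegree_map_le.trans (natDegree_toPoly_le f le_rfl)
  obtain ⟨a, ha⟩ := eq_C_mul_of_mul_conjReflect_eq m (hdeg c) (hdeg c') (hdisc c hc)
    (hdisc c' hc') (by
      rw [← toComplex_toPoly_reflect, ← toComplex_toPoly_reflect, toComplex,
        toComplex, ← Polynomial.map_mul, h, Polynomial.map_mul])
  have hcoeff : ∀ n : Fin (m + 1), (c' n : ℂ) = a * c n := by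
    intro n
    have := congrArg (fun P => P.coeff n) ha
    simpa [coeff_toPoly, tap_of_lt _ n.2] using this
  have hc0 : c 0 ≠ 0 := by
    have h0 := hc.1
    rwa [← Nat.cast_zero, tap_of_lt c m.succ_pos] at h0
  -- The factor is a quotient of real taps, hence real, and its square is one.
  obtain ⟨μ, rfl⟩ : ∃ μ : ℝ, a = μ := ⟨c' 0 / c 0, by
    rw [Complex.ofReal_div, hcoeff 0, mul_div_cancel_right₀ _ (Complex.ofReal_ne_zero.2 hc0)]⟩
  have hμ : ∀ n, c' n = μ * c n := fun n => by exact_mod_cast hcoeff n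
  have hpoly : toPoly c' = Polynomial.C μ * toPoly c := by
    simp [toPoly, hμ, Finset.mul_sum, Polynomial.C_mul_monomial]
  have hne : toPoly c ≠ 0 := fun h0 => hc.1 (by
    rw [← Nat.cast_zero, ← coeff_toPoly, h0, Polynomial.coeff_zero])
  have hne' : toPoly c * toPoly (reflect c) ≠ 0 := by
    rw [toPoly_reflect]
    exact mul_ne_zero hne (by rwa [Ne, Polynomial.reflect_eq_zero_iff])
  have hsq : Polynomial.C (μ ^ 2) = 1 := by
    refine mul_right_cancel₀ hne' ?_
    conv_rhs => rw [one_mul, h, toPoly_reflect, hpoly, Polynomial.reflect_C_mul,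
      ← toPoly_reflect]
    rw [Polynomial.C_pow]; ring
  rw [← Polynomial.C_1] at hsq
  have hsq' : μ ^ 2 = 1 ^ 2 := (Polynomial.C_injective hsq).trans (one_pow 2).symm
  rcases sq_eq_sq_iff_eq_or_eq_neg.1 hsq' with rfl | rfl
  · exact .inl (funext fun n => by simp [hμ])
  · exact .inr (funext fun n => by simp [hμ])

end FIR

/-! ### Limits of the Cholesky rows of the adjusted Gramian matrices -/

theorem mainTheorem3 (M : ℕ) (hM : 0 < M) (g : Fin (2 * M - 1) → ℝ)
    (hg : FIR.IsLinearPhase g) (γ : ℝ)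
    (hpos : ∀ Q : ℕ, (FIR.gramianAdj g γ Q).PosDef) :
    -- every regularized matrix has exactly one Cholesky factor
    (∀ Q : ℕ, ∃! C : Matrix (Fin (2 * Q + M)) (Fin (2 * Q + M)) ℝ,
      FIR.IsCholeskyFactor (FIR.gramianAdj g γ Q) C) ∧
    -- the Orchard-Wilson equations are the factorization on the Z domain
    (∀ c : Fin M → ℝ, FIR.SolvesOrchardWilson c (FIR.lift g γ) ↔
      FIR.IsSpectralFactor c (FIR.lift g γ)) ∧
    ∃ c : Fin M → ℝ,
      -- rows at bounded distance from the symmetry point converge to the taps of c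
      (∀ C : (Q : ℕ) → Matrix (Fin (2 * Q + M)) (Fin (2 * Q + M)) ℝ,
        (∀ Q, FIR.IsCholeskyFactor (FIR.gramianAdj g γ Q) (C Q)) →
          (∀ R : ℕ, ∀ ε : ℝ, 0 < ε → ∀ᶠ Q : ℕ in atTop, ∀ i j : Fin (2 * Q + M),
            |(i : ℤ) - ((Q : ℤ) + M - 1)| ≤ R →
              |C Q i j - FIR.tap c ((j : ℤ) - (i : ℤ))| < ε) ∧
          Tendsto (fun Q : ℕ => FIR.cApprox (C Q)) atTop (𝓝 c)) ∧
      -- the limit is a minimum phase solution of the Orchard-Wilson equations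
      FIR.SolvesOrchardWilson c (FIR.lift g γ) ∧
      FIR.IsMinimumPhase c ∧
      0 < FIR.tap c 0 ∧
      -- its zeros are strictly inside the unit circle if the eigenvalues stay away from zero
      ((∃ δ : ℝ, 0 < δ ∧ ∀ (Q : ℕ) (i : Fin (2 * Q + M)),
          δ ≤ (hpos Q).isHermitian.eigenvalues i) →
        ∀ z : ℂ, 1 ≤ ‖z‖ → FIR.zTransform c z ≠ 0) ∧
      -- it has the magnitude response of every filter with the same matched filter
      (∀ h : Fin M → ℝ, FIR.SolvesOrchardWilson h (FIR.lift g γ) →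
        ∀ Ω : ℝ, ‖FIR.freqResponse c Ω‖ = ‖FIR.freqResponse h Ω‖) ∧
      -- it is the only real minimum phase solution, up to the sign
      (∀ c' : Fin M → ℝ, FIR.SolvesOrchardWilson c' (FIR.lift g γ) → FIR.IsMinimumPhase c' →
        c' = c ∨ c' = -c) := by
  have hlin := hg.lift γ
  have hA := FIR.isPosDefKernel hM hg hpos
  have hchol := FIR.isCholeskyFactor_iff hM hA
  have hOW := fun c : Fin M → ℝ => FIR.solvesOrchardWilson_iff_toPoly hM c hlin
  refine ⟨fun Q => ⟨fun i j => FIR.chol _ i j, (hchol Q _).2 fun _ _ => rfl, fun C hC => ?_⟩,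
    fun c => by rw [hOW, FIR.isSpectralFactor_iff_toPoly], ?_⟩
  · ext i j
    exact (hchol Q C).1 hC i j
  obtain ⟨p, hlim, hband, hp0, hcor, hdisc, hcircle⟩ :=
    FIR.exists_limit_spectralFactor hA (FIR.kernel_succ _) (FIR.kernel_band _)
  set A := FIR.kernel (FIR.lift g γ)
  let c : Fin M → ℝ := fun n => p.coeff n
  have htap : ∀ n : ℕ, FIR.tap c n = p.coeff n := by
    intro n
    rcases lt_or_ge n M with hn | hn
    · rw [FIR.tap_of_lt c hn]
    · rw [FIR.tap_eq_zero c (by omega), hband n hn]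
  have hcp : FIR.toPoly c = p := by
    ext n
    rw [FIR.coeff_toPoly, htap]
  have hc0 : 0 < FIR.tap c 0 := by
    rwa [← htap 0, Nat.cast_zero] at hp0
  have hcOW : FIR.SolvesOrchardWilson c (FIR.lift g γ) := by
    intro k
    have hk : FIR.tap (FIR.lift g γ) ((M : ℤ) - 1 - (k : ℕ)) = A 0 k := by
      rw [show A 0 k = A k 0 from hA.symm 0 k, show A = FIR.kernel _ from rfl, FIR.kernel]
      congr 1; push_cast; ring
    rw [hk, ← hcor k, ← Finset.sum_subset (Finset.range_mono (Nat.sub_le M k))]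
    · refine Finset.sum_congr rfl fun i _ => ?_
      rw [← Nat.cast_add, htap, htap]
    · intro i _ hi
      rw [hband (i + k) (by simp at hi; omega), mul_zero]
  have hmin : ∀ z : ℂ, 1 < ‖z‖ → FIR.zTransform c z ≠ 0 := by
    intro z hz
    rw [FIR.zTransform_eq_eval, hcp]
    refine hdisc _ ?_
    rw [norm_inv]
    exact inv_lt_one_of_one_lt₀ hz
  refine ⟨c, fun C hC => ?_, hcOW, ⟨hc0.ne', hmin⟩, hc0, ?_, fun h hh Ω => ?_,
    fun c' hc' hmin' => ?_⟩
  · have hCe : ∀ Q i j, C Q i j = FIR.chol A i j := fun Q => (hchol Q (C Q)).1 (hC Q)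
    constructor
    · intro R ε hε
      -- Only the `M` diagonals of the band matter, so the convergence is uniform in the column.
      have hunif : ∀ᶠ i in atTop, ∀ k ∈ Finset.range M,
          |FIR.chol A i (i + k) - p.coeff k| < ε := by
        rw [Finset.eventually_all]
        intro k _
        simpa [Real.dist_eq] using Metric.tendsto_nhds.1 (hlim k) ε hε
      obtain ⟨N, hN⟩ := eventually_atTop.1 hunif
      filter_upwards [eventually_ge_atTop (N + R + 1)] with Q hQ i j hij
      have hiN : N ≤ (i : ℕ) := by
        have := (abs_le.1 hij).1
        omega
      rw [hCe]
      rcases lt_or_ge (j : ℕ) (i : ℕ) with hji | hji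
      · rw [FIR.chol_of_lt hji, FIR.tap_eq_zero c (by omega)]
        simpa using hε
      · obtain ⟨k, hk⟩ := Nat.exists_eq_add_of_le hji
        rw [hk, show ((i + k : ℕ) : ℤ) - (i : ℕ) = (k : ℕ) by push_cast; ring, htap]
        rcases lt_or_ge k M with hkM | hkM
        · exact hN i hiN k (Finset.mem_range.2 hkM)
        · rw [FIR.chol_eq_zero_of_band (FIR.kernel_band _) (show (i : ℕ) + M ≤ i + k by omega),
            hband k hkM]
          simpa using hε
    · rw [tendsto_pi_nhds]
      intro k
      have hshift : Tendsto (fun Q : ℕ => Q + (M - 1 - (k : ℕ))) atTop atTop :=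
        tendsto_add_atTop_nat _
      refine ((hlim k).comp hshift).congr fun Q => ?_
      have hcol : FIR.cApprox (C Q) k =
          C Q ⟨Q + (M - 1 - (k : ℕ)), by omega⟩ ⟨Q + (M - 1), by omega⟩ := by
        rw [FIR.cApprox, Matrix.mulVec, dotProduct, Finset.sum_eq_single ⟨Q + (M - 1), by omega⟩]
        · simp [FIR.deltaAug]
        · intro b _ hb
          rw [FIR.deltaAug, if_neg (fun h => hb (Fin.ext h)), mul_zero]
        · simp
      rw [hcol, hCe, Function.comp_apply]
      congr 1
      simp only
      omega
  · rintro ⟨δ, hδ, hle⟩ z hz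
    rcases hz.eq_or_lt with hz1 | hz1
    · rw [FIR.zTransform_eq_eval, hcp]
      refine hcircle ⟨δ, hδ, FIR.le_qform_of_le_eigenvalues hM g hpos hle⟩ _ ?_
      rw [norm_inv, ← hz1, inv_one]
    · exact hmin z hz1
  · rw [FIR.freqResponse, FIR.freqResponse]
    have hw : ‖(Complex.exp (Complex.I * Ω))⁻¹‖ = 1 := by
      rw [norm_inv, mul_comm, Complex.norm_exp_ofReal_mul_I, inv_one]
    exact FIR.norm_zTransform_eq hM (((hOW c).1 hcOW).symm.trans ((hOW h).1 hh)) hw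
  · exact FIR.eq_or_eq_neg_of_isMinimumPhase hM ⟨hc0.ne', hmin⟩ hmin'
      (((hOW c).1 hcOW).symm.trans ((hOW c').1 hc'))
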